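/- Let $\sigma>0$ and consider the discrete-time Gaussian channel with one-bit output quantization: a real input $x_k$ is received as $\tilde Y_k=x_k+Z_k$, where the $Z_k$ are i.i.d. centred Gaussian with variance $\sigma^2$, and the decoder observes $Y_k=1$ if $\tilde Y_k\in\mathcal D$ and $Y_k=-1$ otherwise, where the quantization region $\mathcal D\subset\mathbb R$ is a Borel set. A code of energy $\mathsf E$ consists of an encoder mapping each message $m\in\{1,\dots,\mathsf M\}$ to a sequence $(x_1(m),\dots,x_n(m))\in\mathbb R^n$ with $\sum_{k=1}^n x_k(m)^2\le\mathsf E$, a quantization region $\mathcal D$, and a decoder producing a guess $\hat M$ of the message from $Y_1,\dots,Y_n$; the message $M$ is uniformly distributed on $\{1,\dots,\mathsf M\}$ and independent of the noise. A rate per unit-energy $R$ (in nats per energy) is achievable if for every $\varepsilon>0$ there are codes of energy $\mathsf E$, for all $\mathsf E$, such that $\frac{\log\mathsf M}{\mathsf E}>R-\varepsilon$ for all sufficiently large $\mathsf E$ and $\Pr(\hat M\ne M)\to0$ as $\mathsf E\to\infty$. The capacity per unit-energy $\dot C(0)$ is the supremum of all achievable rates per unit-energy. Then $$\dot C(0)=\frac1{2\sigma^2},$$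 which equals the capacity per unit-energy (defined in the same way) of the Gaussian channel without output quantization, where the decoder observes $\tilde Y_1,\dots,\tilde Y_n$. Moreover, the capacity per unit-energy is achieved by threshold quantizers: for every $\varepsilon>0$ there are a threshold $\Upsilon\in\mathbb R$ and codes of energy $\mathsf E$, for all $\mathsf E$, that all use the quantization region $\mathcal D=\{\tilde y\in\mathbb R:\tilde y\ge\Upsilon\}$, such that $\frac{\log\mathsf M}{\mathsf E}>\frac1{2\sigma^2}-\varepsilon$ for all sufficiently large $\mathsf E$ and $\Pr(\hat M\neq M)\to0$ as $\mathsf E\to\infty$. (The threshold is chosen together with the encoder and may depend on $\varepsilon$.) -/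

import Mathlib

open MeasureTheory ProbabilityTheory Filter Topology
open scoped NNReal

noncomputable section

namespace OneBit

/-- Law of the noise vector `(Z_1, …, Z_n)`: i.i.d. centred Gaussians of variance `σ ^ 2`. -/
def noise (σ : ℝ) (n : ℕ) : Measure (Fin n → ℝ) :=
  Measure.pi fun _ => gaussianReal 0 (σ ^ 2).toNNReal

open Classical in
/-- The one-bit quantizer with quantization region `D`: it produces `1` on `D` and `-1` off `D`. -/
def quantize (D : Set ℝ) (y : ℝ) : ℤˣ := if y ∈ D then 1 else -1

/-- An encoder that maps each of `M` messages to a real sequence of length `n` whose energy does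
not exceed `E`. -/
structure Encoder (E : ℝ≥0) where
  n : ℕ
  M : ℕ
  M_pos : 0 < M
  codeword : Fin M → Fin n → ℝ
  energy_le : ∀ m, ∑ k, codeword m k ^ 2 ≤ (E : ℝ)

/-- The rate per unit-energy `log M / E`, in nats per energy. -/
def Encoder.rate {E : ℝ≥0} (c : Encoder E) : ℝ := Real.log c.M / E

/-- An encoder, a one-bit quantizer (used at every time instant) and a decoder that observes the
quantizer's outputs. -/
structure QuantizedCode (E : ℝ≥0) extends Encoder E where
  region : Set ℝ
  measurableSet_region : MeasurableSet region
  decoder : (Fin n → ℤˣ) → Fin M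

/-- Probability of error for a uniformly distributed message, when the sequence `x` is received as
`x + Z` and then quantized componentwise. -/
def QuantizedCode.errorProb {E : ℝ≥0} (c : QuantizedCode E) (σ : ℝ) : ℝ :=
  (∑ m, (noise σ c.n).real
    {z | c.decoder (fun k => quantize c.region (c.codeword m k + z k)) ≠ m}) / c.M

/-- An encoder and a decoder that observes the unquantized channel outputs. -/
structure UnquantizedCode (E : ℝ≥0) extends Encoder E where
  decoder : (Fin n → ℝ) → Fin M
  measurable_decoder : Measurable decoder

/-- Probability of error for a uniformly distributed message, without quantization. -/
def UnquantizedCode.errorProb {E : ℝ≥0} (c : UnquantizedCode E) (σ : ℝ) : ℝ :=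
  (∑ m, (noise σ c.n).real {z | c.decoder (fun k => c.codeword m k + z k) ≠ m}) / c.M

/-- `R` is an achievable rate per unit-energy of the channel with one-bit output quantization: for
every `ε > 0` there are codes, one for each energy `E`, whose rate per unit-energy exceeds `R - ε`
and whose probability of error tends to zero as `E` tends to infinity. -/
def IsAchievable (σ R : ℝ) : Prop :=
  ∀ ε : ℝ, 0 < ε → ∃ code : ∀ E : ℝ≥0, QuantizedCode E,
    (∀ᶠ E in atTop, R - ε < (code E).rate) ∧
      Tendsto (fun E => (code E).errorProb σ) atTop (𝓝 0)

/-- The same notion for the channel without output quantization. -/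
def IsAchievableUnquantized (σ R : ℝ) : Prop :=
  ∀ ε : ℝ, 0 < ε → ∃ code : ∀ E : ℝ≥0, UnquantizedCode E,
    (∀ᶠ E in atTop, R - ε < (code E).rate) ∧
      Tendsto (fun E => (code E).errorProb σ) atTop (𝓝 0)

/-- `R` is achievable with threshold quantizers: for every `ε > 0` there is a threshold `Υ` such
that codes as above exist which all use the quantization region `{y | Υ ≤ y}`. -/
def IsAchievableByThreshold (σ R : ℝ) : Prop :=
  ∀ ε : ℝ, 0 < ε → ∃ Υ : ℝ, ∃ code : ∀ E : ℝ≥0, QuantizedCode E,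
    (∀ E, (code E).region = {y : ℝ | Υ ≤ y}) ∧
      (∀ᶠ E in atTop, R - ε < (code E).rate) ∧
        Tendsto (fun E => (code E).errorProb σ) atTop (𝓝 0)

/-- Capacity per unit-energy of the Gaussian channel with one-bit output quantization: the supremum
of all achievable rates per unit-energy. -/
def capacityPerUnitEnergy (σ : ℝ) : EReal :=
  ⨆ R ∈ {R : ℝ | IsAchievable σ R}, (R : EReal)

/-- Capacity per unit-energy of the Gaussian channel without output quantization. -/
def capacityPerUnitEnergyUnquantized (σ : ℝ) : EReal :=
  ⨆ R ∈ {R : ℝ | IsAchievableUnquantized σ R}, (R : EReal)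

end OneBit

end

open MeasureTheory ProbabilityTheory Filter Topology
open scoped NNReal

namespace OneBit

variable {σ : ℝ} {n : ℕ}

/-! Converse: a decoder that sees the unquantized outputs can quantize them itself, so it suffices
to bound the unquantized channel. Compare each codeword with silence. Given a codeword of energy at
most `E`, the log-likelihood ratio against pure noise exceeds `(1 + δ) * E / (2 * σ ^ 2)` only with
exponentially small probability (`noise_map_add_le`). A reliably decoded message therefore needs a
decoding region of noise probability about `exp (-(1 + δ) * E / (2 * σ ^ 2))` or more, and disjoint
regions leave room for few messages (`UnquantizedCode.one_le_errorProb_add`).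

Achievability: signal with rare, strong pulses and put the threshold just below the pulse amplitude
`ξ`. Noise alone crosses it with exponent close to `ξ ^ 2 / (2 * σ ^ 2)`, that is `1 / (2 * σ ^ 2)`
per unit of pulse energy, so one bit loses almost nothing (`pulsePositionCode_errorProb_le`). The
combinatorial overhead is a constant factor per pulse, negligible once the fixed `ξ` is large. -/

instance (σ : ℝ) (n : ℕ) : IsProbabilityMeasure (noise σ n) := by
  unfold noise; infer_instance

lemma coe_toNNReal_sq (σ : ℝ) : ((σ ^ 2).toNNReal : ℝ) = σ ^ 2 :=
  Real.coe_toNNReal _ (sq_nonneg σ)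

lemma toNNReal_sq_ne_zero (hσ : 0 < σ) : (σ ^ 2).toNNReal ≠ 0 := by
  simpa using hσ.ne'

/-! ### Gaussian tails -/

lemma hasSubgaussianMGF_id_gaussianReal (v : ℝ≥0) :
    HasSubgaussianMGF id v (gaussianReal 0 v) where
  integrable_exp_mul t := integrable_exp_mul_gaussianReal t
  mgf_le t := by rw [mgf_id_gaussianReal]; simp

/-- Chernoff bound for the upper tail of a centred Gaussian. -/
lemma gaussianReal_Ici_le (σ : ℝ) {a : ℝ} (ha : 0 ≤ a) :
    (gaussianReal 0 (σ ^ 2).toNNReal).real (Set.Ici a) ≤ Real.exp (-(a ^ 2 / (2 * σ ^ 2))) := by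
  have h := (hasSubgaussianMGF_id_gaussianReal (σ ^ 2).toNNReal).measure_ge_le ha
  rw [coe_toNNReal_sq, neg_div] at h
  exact h

/-- Chernoff bound for the lower tail of a centred Gaussian. -/
lemma gaussianReal_Iio_neg_le (σ : ℝ) {a : ℝ} (ha : 0 ≤ a) :
    (gaussianReal 0 (σ ^ 2).toNNReal).real (Set.Iio (-a)) ≤
      Real.exp (-(a ^ 2 / (2 * σ ^ 2))) := by
  have h := (hasSubgaussianMGF_id_gaussianReal (σ ^ 2).toNNReal).neg.measure_ge_le ha
  rw [coe_toNNReal_sq, neg_div] at h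
  refine le_trans (measureReal_mono fun z hz => ?_) h
  simp only [Set.mem_Iio] at hz
  simp only [Set.mem_ofPred_eq, Pi.neg_apply, id]
  linarith

/-! ### Change of measure and the converse -/

/-- Likelihood ratio of the output law given the input `x` to the noise law. -/
noncomputable def likelihoodRatio (σ : ℝ) (x z : Fin n → ℝ) : ℝ :=
  ∏ k, Real.exp (x k * z k / σ ^ 2 - x k ^ 2 / (2 * σ ^ 2))

lemma likelihoodRatio_eq_exp (x z : Fin n → ℝ) :
    likelihoodRatio σ x z =
      Real.exp ((∑ k, x k * z k) / σ ^ 2 - (∑ k, x k ^ 2) / (2 * σ ^ 2)) := by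
  rw [likelihoodRatio, ← Real.exp_sum, Finset.sum_sub_distrib, Finset.sum_div, Finset.sum_div]

lemma measurable_likelihoodRatio (x : Fin n → ℝ) : Measurable (likelihoodRatio σ x) := by
  unfold likelihoodRatio; fun_prop

lemma gaussianReal_eq_withDensity (hσ : 0 < σ) (a : ℝ) :
    gaussianReal a (σ ^ 2).toNNReal = (gaussianReal 0 (σ ^ 2).toNNReal).withDensity
      fun z => ENNReal.ofReal (Real.exp (a * z / σ ^ 2 - a ^ 2 / (2 * σ ^ 2))) := by
  have hv := toNNReal_sq_ne_zero hσ
  rw [gaussianReal_of_var_ne_zero _ hv, gaussianReal_of_var_ne_zero _ hv,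
    ← withDensity_mul _ (measurable_gaussianPDF _ _) (by fun_prop)]
  congr 1
  ext z
  simp only [gaussianPDF, gaussianPDFReal, Pi.mul_apply, coe_toNNReal_sq]
  rw [← ENNReal.ofReal_mul (by positivity),
    mul_assoc _ (Real.exp (-(z - 0) ^ 2 / (2 * σ ^ 2))), ← Real.exp_add]
  congr 3
  field_simp
  ring

lemma integrable_exp_linear_gaussianReal (v : ℝ≥0) (b c : ℝ) :
    Integrable (fun z => Real.exp (b * z / c - b ^ 2 / (2 * c))) (gaussianReal 0 v) := by
  have h := (integrable_exp_mul_gaussianReal (μ := 0) (v := v) (b / c)).mul_const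
    (Real.exp (-(b ^ 2 / (2 * c))))
  refine h.congr (ae_of_all _ fun z => ?_)
  simp only [← Real.exp_add]
  congr 1
  ring

/-- The law of `x + Z`. -/
lemma noise_map_add (σ : ℝ) (x : Fin n → ℝ) :
    (noise σ n).map (fun z k => x k + z k) =
      Measure.pi fun k => gaussianReal (x k) (σ ^ 2).toNNReal := by
  unfold noise
  rw [Measure.pi_map_pi (fun _ => by fun_prop)]
  simp_rw [gaussianReal_map_const_add, zero_add]

/-- Change of measure: the law of `x + Z` has density `likelihoodRatio σ x` with respect to the
noise law. -/
lemma noise_map_add_eq_withDensity (hσ : 0 < σ) (x : Fin n → ℝ) :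
    (noise σ n).map (fun z k => x k + z k) =
      (noise σ n).withDensity fun z => ENNReal.ofReal (likelihoodRatio σ x z) := by
  rw [noise_map_add]
  -- Boxes determine the measure, and on a box the integral of the likelihood ratio factorizes.
  refine Measure.pi_eq fun s hs => ?_
  rw [withDensity_apply _ (MeasurableSet.univ_pi hs), noise, Measure.restrict_pi_pi,
    ← ofReal_integral_eq_lintegral_ofReal]
  · unfold likelihoodRatio
    rw [integral_fintype_prod_eq_prod
      (f := fun k z => Real.exp (x k * z / σ ^ 2 - x k ^ 2 / (2 * σ ^ 2))),
      ENNReal.ofReal_prod_of_nonneg fun k _ => integral_nonneg fun z => (Real.exp_pos _).le]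
    refine Finset.prod_congr rfl fun k _ => ?_
    rw [gaussianReal_eq_withDensity hσ (x k), withDensity_apply _ (hs k),
      ofReal_integral_eq_lintegral_ofReal]
    · exact (integrable_exp_linear_gaussianReal _ _ _).restrict
    · exact ae_of_all _ fun z => (Real.exp_pos _).le
  · exact Integrable.fintype_prod
      (f := fun k z => Real.exp (x k * z / σ ^ 2 - x k ^ 2 / (2 * σ ^ 2)))
      fun k => (integrable_exp_linear_gaussianReal _ _ _).restrict
  · exact ae_of_all _ fun z => Finset.prod_nonneg fun k _ => (Real.exp_pos _).le

/-- The correlation of the noise with a sequence of energy at most `E` is sub-Gaussian. -/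
lemma hasSubgaussianMGF_correlation (σ : ℝ) {E : ℝ≥0} {x : Fin n → ℝ}
    (hx : ∑ k, x k ^ 2 ≤ (E : ℝ)) :
    HasSubgaussianMGF (fun z : Fin n → ℝ => ∑ k, x k * z k) (E * (σ ^ 2).toNNReal)
      (noise σ n) := by
  have hind : iIndepFun (fun k (z : Fin n → ℝ) => x k * z k) (noise σ n) :=
    iIndepFun_pi (X := fun k z => x k * z) fun k => by fun_prop
  have hsub (k : Fin n) : HasSubgaussianMGF (fun z : Fin n → ℝ => x k * z k)
      ((x k ^ 2).toNNReal * (σ ^ 2).toNNReal) (noise σ n) := by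
    have h := (hasSubgaussianMGF_id_gaussianReal (σ ^ 2).toNNReal).const_mul (x k)
    have hmap : (noise σ n).map (fun z => z k) = gaussianReal 0 (σ ^ 2).toNNReal :=
      (measurePreserving_eval (fun _ => gaussianReal 0 (σ ^ 2).toNNReal) k).map_eq
    rw [← hmap] at h
    rw [Real.toNNReal_of_nonneg (sq_nonneg (x k))]
    exact HasSubgaussianMGF.of_map (measurable_pi_apply k).aemeasurable h
  have hsum := HasSubgaussianMGF.sum_of_iIndepFun hind (s := Finset.univ) fun k _ => hsub k
  refine ⟨hsum.integrable_exp_mul, fun t => (hsum.mgf_le t).trans ?_⟩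
  gcongr
  rw [← NNReal.coe_le_coe]
  push_cast
  simp_rw [← Finset.sum_mul, coe_toNNReal_sq (x _)]
  gcongr

/-- Strong-converse bound for a single message. -/
lemma noise_map_add_le (hσ : 0 < σ) {E : ℝ≥0} (hE : 0 < E) {δ : ℝ} (hδ : 0 < δ)
    {x : Fin n → ℝ} (hx : ∑ k, x k ^ 2 ≤ (E : ℝ)) {A : Set (Fin n → ℝ)} (hA : MeasurableSet A) :
    ((noise σ n).map (fun z k => x k + z k)).real A ≤
      Real.exp (-(δ ^ 2 * E / (8 * σ ^ 2))) +
        Real.exp ((1 + δ) * E / (2 * σ ^ 2)) * (noise σ n).real A := by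
  have hmeas : Measurable fun (z : Fin n → ℝ) k => x k + z k := by fun_prop
  set P := (noise σ n).map (fun z k => x k + z k) with hP
  have hPprob : IsProbabilityMeasure P := Measure.isProbabilityMeasure_map hmeas.aemeasurable
  -- Given `x`, the log-likelihood ratio has mean at most `E / (2 * σ ^ 2)`; `T` allows a relative
  -- excess `δ`. Exceeding it forces the correlation of `x` with the noise above `δ * E / 2`.
  set T := Real.exp ((1 + δ) * E / (2 * σ ^ 2)) with hT
  set S := {z | T < likelihoodRatio σ x z} with hS
  have hSm : MeasurableSet S := measurableSet_lt measurable_const (measurable_likelihoodRatio x)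
  have htail : P.real S ≤ Real.exp (-(δ ^ 2 * E / (8 * σ ^ 2))) := by
    rw [hP, map_measureReal_apply hmeas hSm]
    have hE' : (0 : ℝ) < E := hE
    have h := (hasSubgaussianMGF_correlation σ hx).measure_ge_le
      (ε := δ * E / 2) (by positivity)
    refine (measureReal_mono fun z hz => ?_).trans (h.trans_eq ?_)
    · simp only [hS, hT, Set.mem_preimage, Set.mem_ofPred_eq, likelihoodRatio_eq_exp,
        Real.exp_lt_exp] at hz ⊢
      have h1 : ∑ k, x k * (x k + z k) = ∑ k, x k ^ 2 + ∑ k, x k * z k := by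
        rw [← Finset.sum_add_distrib]; congr 1; ext k; ring
      rw [h1] at hz
      have hs : 0 < σ ^ 2 := by positivity
      have h2 : (∑ k, x k ^ 2 + ∑ k, x k * z k) / σ ^ 2 - (∑ k, x k ^ 2) / (2 * σ ^ 2) =
          (∑ k, x k ^ 2 + 2 * ∑ k, x k * z k) / (2 * σ ^ 2) := by field_simp; ring
      rw [h2, div_lt_div_iff_of_pos_right (by positivity)] at hz
      linarith
    · push_cast
      rw [coe_toNNReal_sq]
      congr 1
      field_simp
      ring
  have hrest : P.real (A \ S) ≤ T * (noise σ n).real A := by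
    have hle : P (A \ S) ≤ ENNReal.ofReal T * noise σ n A := by
      rw [hP, noise_map_add_eq_withDensity hσ, withDensity_apply _ (hA.diff hSm)]
      calc ∫⁻ z in A \ S, ENNReal.ofReal (likelihoodRatio σ x z) ∂noise σ n
          ≤ ∫⁻ _ in A \ S, ENNReal.ofReal T ∂noise σ n :=
            setLIntegral_mono measurable_const fun z hz =>
              ENNReal.ofReal_le_ofReal (not_lt.1 hz.2)
        _ = ENNReal.ofReal T * noise σ n (A \ S) := by simp
        _ ≤ _ := by gcongr; exact Set.sdiff_subset
    have := ENNReal.toReal_mono (by finiteness) hle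
    rwa [ENNReal.toReal_mul, ENNReal.toReal_ofReal (Real.exp_pos _).le] at this
  calc P.real A ≤ P.real (S ∪ A \ S) := measureReal_mono (by simp)
    _ ≤ P.real S + P.real (A \ S) := measureReal_union_le _ _
    _ ≤ _ := add_le_add htail hrest

/-- Sum the single-message bound over the decoding regions: they are disjoint, so their noise
probabilities add up to at most 1. -/
lemma UnquantizedCode.one_le_errorProb_add (hσ : 0 < σ) {E : ℝ≥0} (hE : 0 < E)
    (c : UnquantizedCode E) {δ : ℝ} (hδ : 0 < δ) :
    1 ≤ c.errorProb σ + Real.exp (-(δ ^ 2 * E / (8 * σ ^ 2))) +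
      Real.exp ((1 + δ) * E / (2 * σ ^ 2)) / c.M := by
  have hM : (0 : ℝ) < c.M := Nat.cast_pos.2 c.M_pos
  set a := Real.exp (-(δ ^ 2 * E / (8 * σ ^ 2)))
  set T := Real.exp ((1 + δ) * E / (2 * σ ^ 2))
  have hA (m : Fin c.M) : MeasurableSet (c.decoder ⁻¹' {m}) :=
    c.measurable_decoder (measurableSet_singleton m)
  have hmsg (m : Fin c.M) :
      1 ≤ (noise σ c.n).real {z | c.decoder (fun k => c.codeword m k + z k) ≠ m} +
        (a + T * (noise σ c.n).real (c.decoder ⁻¹' {m})) := by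
    have hmeas : Measurable fun (z : Fin c.n → ℝ) k => c.codeword m k + z k := by fun_prop
    have h1 := noise_map_add_le hσ hE hδ (c.energy_le m) (hA m)
    rw [map_measureReal_apply hmeas (hA m)] at h1
    have h2 := probReal_compl_eq_one_sub (μ := noise σ c.n) (hmeas (hA m))
    have h3 : ((fun (z : Fin c.n → ℝ) k => c.codeword m k + z k) ⁻¹' (c.decoder ⁻¹' {m}))ᶜ =
        {z | c.decoder (fun k => c.codeword m k + z k) ≠ m} := rfl
    rw [h3] at h2
    linarith
  have htot : ∑ m, (noise σ c.n).real (c.decoder ⁻¹' {m}) ≤ 1 := by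
    rw [← measureReal_biUnion_finset (fun i _ j _ hij => ?_) fun m _ => hA m]
    · exact measureReal_le_one
    · exact Disjoint.preimage _ (by simpa using hij)
  have hsum := Finset.sum_le_sum fun m (_ : m ∈ Finset.univ) => hmsg m
  simp only [Finset.sum_add_distrib, Finset.sum_const, Finset.card_univ, Fintype.card_fin,
    nsmul_eq_mul, mul_one, ← Finset.mul_sum] at hsum
  have hT : T * ∑ m, (noise σ c.n).real (c.decoder ⁻¹' {m}) ≤ T :=
    mul_le_of_le_one_right (Real.exp_pos _).le htot
  rw [UnquantizedCode.errorProb]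
  have hrw : ∀ s : ℝ, s / c.M + a + T / c.M = (s + c.M * a + T) / c.M := fun s => by field_simp
  rw [hrw, one_le_div hM]
  linarith

/-- Converse for the unquantized channel. -/
theorem IsAchievableUnquantized.le (hσ : 0 < σ) {R : ℝ} (hR : IsAchievableUnquantized σ R) :
    R ≤ 1 / (2 * σ ^ 2) := by
  by_contra! hlt
  set ε := (R - 1 / (2 * σ ^ 2)) / 2 with hε
  have hεpos : 0 < ε := by rw [hε]; linarith
  have hs : 0 < σ ^ 2 := by positivity
  obtain ⟨code, hrate, herr⟩ := hR ε hεpos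
  -- With `δ = σ ^ 2 * ε` the threshold exponent is `(1 / (2 * σ ^ 2) + ε / 2) * E`, while `log M`
  -- exceeds `(1 / (2 * σ ^ 2) + ε) * E`; the gap `ε / 2 * E` makes the last term vanish.
  have hδ : 0 < σ ^ 2 * ε := by positivity
  have hcoe : Tendsto (fun E : ℝ≥0 => (E : ℝ)) atTop atTop := NNReal.tendsto_coe_atTop.2 tendsto_id
  have hexp (c : ℝ) (hc : 0 < c) : Tendsto (fun E : ℝ≥0 => Real.exp (-(c * E))) atTop (𝓝 0) :=
    Real.tendsto_exp_neg_atTop_nhds_zero.comp (hcoe.const_mul_atTop hc)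
  have hlim := (herr.add (hexp ((σ ^ 2 * ε) ^ 2 / (8 * σ ^ 2)) (by positivity))).add
    (hexp (ε / 2) (by positivity))
  have hge : ∀ᶠ E : ℝ≥0 in atTop, (1 : ℝ) ≤ (code E).errorProb σ +
      Real.exp (-((σ ^ 2 * ε) ^ 2 / (8 * σ ^ 2) * E)) + Real.exp (-(ε / 2 * E)) := by
    filter_upwards [hrate, eventually_gt_atTop 0] with E hr hE
    have hE' : (0 : ℝ) < E := hE
    refine ((code E).one_le_errorProb_add hσ hE hδ).trans ?_
    have hM : (0 : ℝ) < (code E).M := Nat.cast_pos.2 (code E).M_pos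
    have hlog : (1 / (2 * σ ^ 2) + ε) * E < Real.log (code E).M := by
      rw [Encoder.rate, lt_div_iff₀ hE'] at hr
      have : 1 / (2 * σ ^ 2) + ε = R - ε := by rw [hε]; ring
      rwa [this]
    have hlast : Real.exp ((1 + σ ^ 2 * ε) * E / (2 * σ ^ 2)) / (code E).M ≤
        Real.exp (-(ε / 2 * E)) := by
      rw [div_le_iff₀ hM]
      conv_rhs => rw [← Real.exp_log hM]
      rw [← Real.exp_add, Real.exp_le_exp]
      have : (1 + σ ^ 2 * ε) * E / (2 * σ ^ 2) = (1 / (2 * σ ^ 2) + ε) * E - ε / 2 * E := by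
        field_simp; ring
      linarith
    have hmid : (σ ^ 2 * ε) ^ 2 * E / (8 * σ ^ 2) = (σ ^ 2 * ε) ^ 2 / (8 * σ ^ 2) * E := by ring
    rw [hmid]
    gcongr
  have := ge_of_tendsto hlim hge
  norm_num at this

/-! ### Achievability by pulse-position modulation -/

open Classical in
/-- Among the coordinates in `J`, the probability that a fraction `τ` of them falls into a set of
probability at most `p` is at most `(2 * p ^ τ) ^ #J`. -/
lemma pi_card_filter_ge_le {ι : Type*} [Fintype ι] (μ : Measure ℝ) [IsProbabilityMeasure μ]
    (J : Finset ι) (A : Set ℝ) {p τ : ℝ} (hp : 0 < p) (hp1 : p ≤ 1) (hA : μ.real A ≤ p) :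
    (Measure.pi fun _ : ι => μ).real
      {z | τ * J.card ≤ ((J.filter fun k => z k ∈ A).card : ℝ)} ≤ (2 * p ^ τ) ^ J.card := by
  -- Union bound over the possible index sets of hits: at most `2 ^ #J` of them, each of probability
  -- at most `p ^ (τ * #J)`.
  set F := J.powerset.filter fun I => τ * J.card ≤ (I.card : ℝ)
  have hsub : {z : ι → ℝ | τ * J.card ≤ ((J.filter fun k => z k ∈ A).card : ℝ)} ⊆
      ⋃ I ∈ F, {z : ι → ℝ | ∀ k ∈ I, z k ∈ A} := by
    intro z hz
    simp only [Set.mem_iUnion]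
    refine ⟨J.filter fun k => z k ∈ A, ?_, fun k hk => (Finset.mem_filter.1 hk).2⟩
    exact Finset.mem_filter.2 ⟨Finset.mem_powerset.2 (Finset.filter_subset _ _), hz⟩
  have hI (I : Finset ι) (hmem : I ∈ F) :
      (Measure.pi fun _ : ι => μ).real {z | ∀ k ∈ I, z k ∈ A} ≤ (p ^ τ) ^ J.card := by
    have heq : {z : ι → ℝ | ∀ k ∈ I, z k ∈ A} =
        Set.univ.pi fun k => if k ∈ I then A else Set.univ := by
      ext z
      simp only [Set.mem_ofPred_eq, Set.mem_univ_pi]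
      refine forall_congr' fun k => ?_
      split_ifs with h <;> simp [h]
    have hval : (Measure.pi fun _ : ι => μ).real {z | ∀ k ∈ I, z k ∈ A} = μ.real A ^ I.card := by
      rw [heq, Measure.real, Measure.pi_pi, ENNReal.toReal_prod]
      simp [apply_ite, Measure.real, Finset.prod_ite_mem]
    rw [hval]
    calc μ.real A ^ I.card ≤ p ^ I.card := by gcongr
      _ = p ^ (I.card : ℝ) := (Real.rpow_natCast _ _).symm
      _ ≤ p ^ (τ * J.card) :=
        Real.rpow_le_rpow_of_exponent_ge hp hp1 (Finset.mem_filter.1 hmem).2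
      _ = (p ^ τ) ^ J.card := by rw [Real.rpow_mul hp.le, Real.rpow_natCast]
  calc _ ≤ (Measure.pi fun _ : ι => μ).real (⋃ I ∈ F, {z : ι → ℝ | ∀ k ∈ I, z k ∈ A}) :=
        measureReal_mono hsub (measure_ne_top _ _)
    _ ≤ ∑ I ∈ F, (Measure.pi fun _ : ι => μ).real {z : ι → ℝ | ∀ k ∈ I, z k ∈ A} :=
        measureReal_biUnion_finset_le _ _
    _ ≤ ∑ _I ∈ F, (p ^ τ) ^ J.card := Finset.sum_le_sum hI
    _ = F.card * (p ^ τ) ^ J.card := by simp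
    _ ≤ 2 ^ J.card * (p ^ τ) ^ J.card := by
        gcongr
        have : F.card ≤ 2 ^ J.card :=
          (Finset.card_filter_le _ _).trans_eq (Finset.card_powerset J)
        exact_mod_cast this
    _ = _ := (mul_pow _ _ _).symm

/-- The `m`-th of `M` consecutive blocks of `L` time instants. -/
def block (M L : ℕ) (m : Fin M) : Finset (Fin (M * L)) :=
  Finset.univ.filter fun k => (finProdFinEquiv.symm k).1 = m

lemma card_block (M L : ℕ) (m : Fin M) : (block M L m).card = L := by
  have h : block M L m =
      (Finset.univ : Finset (Fin L)).image fun l => finProdFinEquiv (m, l) := by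
    ext k
    obtain ⟨⟨i, l⟩, rfl⟩ := finProdFinEquiv.surjective k
    simp only [block, Finset.mem_filter, Finset.mem_univ, true_and, Equiv.symm_apply_apply,
      Finset.mem_image, EmbeddingLike.apply_eq_iff_eq, Prod.mk.injEq]
    simp [eq_comm]
  rw [h, Finset.card_image_of_injective _ fun a b hab => by simpa using hab]
  simp

/-- Pulse-position modulation: message `m` is sent as pulses of amplitude `ξ` in the `m`-th block of
`L` time instants, and the transmitter is silent otherwise. -/
def pulsePositionEncoder {E : ℝ≥0} (ξ : ℝ) (M L : ℕ) (hM : 0 < M) (hL : L * ξ ^ 2 ≤ E) :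
    Encoder E where
  n := M * L
  M := M
  M_pos := hM
  codeword m k := if k ∈ block M L m then ξ else 0
  energy_le m := by
    simpa [ite_pow, Finset.sum_ite_mem, card_block] using hL

open Classical in
/-- Pulse-position modulation with threshold quantizer; the decoder looks for a block in which at
least a fraction `τ` of the outputs is `1`. -/
noncomputable def pulsePositionCode {E : ℝ≥0} (ξ Υ τ : ℝ) (M L : ℕ) (hM : 0 < M)
    (hL : L * ξ ^ 2 ≤ E) : QuantizedCode E where
  toEncoder := pulsePositionEncoder ξ M L hM hL
  region := {y | Υ ≤ y}
  measurableSet_region := measurableSet_Ici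
  decoder y :=
    if h : ∃ m : Fin M, τ * L ≤ (((block M L m).filter fun k => y k = 1).card : ℝ) then h.choose
    else ⟨0, hM⟩

lemma quantize_eq_one_iff (D : Set ℝ) (y : ℝ) : quantize D y = 1 ↔ y ∈ D := by
  unfold quantize
  split_ifs with h
  · simp [h]
  · simp only [h, iff_false]; decide

-- A pulse is missed only if the noise is below `-(η * ξ)`, and losing the block takes a fraction
-- `η` of misses: `η ^ 2` from the tail times `η` from the fraction gives `η ^ 3`. A false alarm
-- likewise yields `(1 - η) ^ 3`, and the union over the other blocks costs the factor `M`.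
open Classical in
lemma pulsePositionCode_errorProb_le {E : ℝ≥0} {ξ η : ℝ} (hξ : 0 ≤ ξ) (hη : 0 ≤ η) (hη1 : η ≤ 1)
    {M L : ℕ} (hM : 0 < M) (hL : L * ξ ^ 2 ≤ E) :
    (pulsePositionCode ξ ((1 - η) * ξ) (1 - η) M L hM hL).errorProb σ ≤
      (2 * Real.exp (-(η ^ 3 * ξ ^ 2 / (2 * σ ^ 2)))) ^ L +
        M * (2 * Real.exp (-((1 - η) ^ 3 * ξ ^ 2 / (2 * σ ^ 2)))) ^ L := by
  set c := pulsePositionCode ξ ((1 - η) * ξ) (1 - η) M L hM hL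
  set μ := gaussianReal 0 (σ ^ 2).toNNReal
  set b₁ := (2 * Real.exp (-(η ^ 3 * ξ ^ 2 / (2 * σ ^ 2)))) ^ L
  set b₂ := (2 * Real.exp (-((1 - η) ^ 3 * ξ ^ 2 / (2 * σ ^ 2)))) ^ L
  set miss : Fin M → Set (Fin (M * L) → ℝ) := fun m =>
    {z | η * (block M L m).card ≤
      (((block M L m).filter fun k => z k ∈ Set.Iio (-(η * ξ))).card : ℝ)} with hmiss
  set alarm : Fin M → Set (Fin (M * L) → ℝ) := fun m =>
    {z | (1 - η) * (block M L m).card ≤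
      (((block M L m).filter fun k => z k ∈ Set.Ici ((1 - η) * ξ)).card : ℝ)} with halarm
  have hτ : 0 ≤ 1 - η := by linarith
  have hbound₁ (m : Fin M) : (noise σ (M * L)).real (miss m) ≤ b₁ := by
    have h := pi_card_filter_ge_le μ (block M L m) (Set.Iio (-(η * ξ))) (τ := η)
      (Real.exp_pos _) (Real.exp_le_one_iff.2 (by rw [neg_nonpos]; positivity))
      (gaussianReal_Iio_neg_le σ (mul_nonneg hη hξ))
    refine h.trans_eq ?_
    rw [card_block, ← Real.exp_mul]
    congr 3
    ring
  have hbound₂ (m : Fin M) : (noise σ (M * L)).real (alarm m) ≤ b₂ := by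
    have h := pi_card_filter_ge_le μ (block M L m) (Set.Ici ((1 - η) * ξ)) (τ := 1 - η)
      (Real.exp_pos _) (Real.exp_le_one_iff.2 (by rw [neg_nonpos]; positivity))
      (gaussianReal_Ici_le σ (mul_nonneg hτ hξ))
    refine h.trans_eq ?_
    rw [card_block, ← Real.exp_mul]
    congr 3
    ring
  have hout (m m' : Fin M) (z : Fin (M * L) → ℝ) (k : Fin (M * L)) (hk : k ∈ block M L m') :
      quantize c.region (c.codeword m k + z k) = 1 ↔
        (1 - η) * ξ ≤ (if m' = m then ξ else 0) + z k := by
    rw [quantize_eq_one_iff]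
    change (1 - η) * ξ ≤ (if k ∈ block M L m then ξ else 0) + z k ↔ _
    have : k ∈ block M L m ↔ m' = m := by
      simp only [block, Finset.mem_filter, Finset.mem_univ, true_and] at hk ⊢
      rw [hk]
    simp only [this]
  have herr (m : Fin M) :
      {z : Fin (M * L) → ℝ | c.decoder (fun k => quantize c.region (c.codeword m k + z k)) ≠ m} ⊆
        miss m ∪ ⋃ m' ∈ Finset.univ.erase m, alarm m' := by
    intro z hz
    by_contra hcon
    simp only [Set.mem_union, Set.mem_iUnion, Finset.mem_erase, Finset.mem_univ, and_true, not_or,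
      not_exists] at hcon
    obtain ⟨h1, h2⟩ := hcon
    apply hz
    set y : Fin (M * L) → ℤˣ := fun k => quantize c.region (c.codeword m k + z k)
    -- Without false alarms only the true block can pass the test, so the arbitrary choice in the
    -- decoder is harmless.
    have huniq (m' : Fin M)
        (h : (1 - η) * L ≤ (((block M L m').filter fun k => y k = 1).card : ℝ)) : m' = m := by
      by_contra hne
      refine h2 m' hne ?_
      simp only [halarm, Set.mem_ofPred_eq, card_block]
      rw [Finset.filter_congr fun k hk => hout m m' z k hk] at h
      simpa [hne] using h
    have hex : ∃ m' : Fin M,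
        (1 - η) * L ≤ (((block M L m').filter fun k => y k = 1).card : ℝ) := by
      refine ⟨m, ?_⟩
      rw [Finset.filter_congr fun k hk => hout m m z k hk]
      simp only [hmiss, Set.mem_ofPred_eq, card_block, not_le, Set.mem_Iio] at h1
      have hcard := Finset.card_filter_add_card_filter_not (s := block M L m)
        fun k => z k < -(η * ξ)
      rw [card_block] at hcard
      have hcard' : (((block M L m).filter fun k => z k < -(η * ξ)).card : ℝ) +
          ((block M L m).filter fun k => ¬ z k < -(η * ξ)).card = L := by exact_mod_cast hcard
      have hcongr : ((block M L m).filter fun k => (1 - η) * ξ ≤ (if m = m then ξ else 0) + z k) =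
          (block M L m).filter fun k => ¬ z k < -(η * ξ) := by
        refine Finset.filter_congr fun k _ => ?_
        simp only [if_true, not_lt]
        constructor <;> intro h <;> linarith
      rw [hcongr]
      linarith
    change (if h : ∃ m' : Fin M, (1 - η) * L ≤
      (((block M L m').filter fun k => y k = 1).card : ℝ) then h.choose else ⟨0, hM⟩) = m
    rw [dif_pos hex]
    exact huniq _ hex.choose_spec
  have hb₂ : 0 ≤ b₂ := by positivity
  have hmsg (m : Fin M) : (noise σ (M * L)).real
      {z | c.decoder (fun k => quantize c.region (c.codeword m k + z k)) ≠ m} ≤ b₁ + M * b₂ := by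
    calc _ ≤ (noise σ (M * L)).real (miss m ∪ ⋃ m' ∈ Finset.univ.erase m, alarm m') :=
          measureReal_mono (herr m)
      _ ≤ (noise σ (M * L)).real (miss m) +
          (noise σ (M * L)).real (⋃ m' ∈ Finset.univ.erase m, alarm m') :=
          measureReal_union_le _ _
      _ ≤ b₁ + ∑ m' ∈ Finset.univ.erase m, (noise σ (M * L)).real (alarm m') :=
          add_le_add (hbound₁ m) (measureReal_biUnion_finset_le _ _)
      _ ≤ b₁ + ∑ m' : Fin M, b₂ := by
          gcongr
          refine (Finset.sum_le_sum fun m' _ => hbound₂ m').trans ?_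
          exact Finset.sum_le_sum_of_subset_of_nonneg (Finset.subset_univ _) fun _ _ _ => hb₂
      _ = b₁ + M * b₂ := by simp
  have hM' : (0 : ℝ) < M := Nat.cast_pos.2 hM
  change (∑ m : Fin M, (noise σ (M * L)).real
    {z | c.decoder (fun k => quantize c.region (c.codeword m k + z k)) ≠ m}) / (M : ℝ) ≤ _
  rw [div_le_iff₀ hM']
  refine (Finset.sum_le_sum fun m _ => hmsg m).trans_eq ?_
  simp only [Finset.sum_const, Finset.card_univ, Fintype.card_fin, nsmul_eq_mul]
  ring

/-- `⌈exp (ρ * E)⌉ * b ^ ⌊E / s⌋` tends to zero if `b` decays faster than `exp (-ρ * s)`. -/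
lemma tendsto_ceil_exp_mul_pow_floor {ρ s b : ℝ} (hρ : 0 ≤ ρ) (hs : 0 < s) (hb : 0 < b)
    (hb1 : b < 1) (h : ρ * s + Real.log b < 0) :
    Tendsto (fun x : ℝ => (⌈Real.exp (ρ * x)⌉₊ : ℝ) * b ^ ⌊x / s⌋₊) atTop (𝓝 0) := by
  have hlog : Real.log b < 0 := Real.log_neg hb hb1
  have hneg : 0 < -(ρ + Real.log b / s) := by
    have : ρ + Real.log b / s = (ρ * s + Real.log b) / s := by field_simp
    rw [this, neg_pos]
    exact div_neg_of_neg_of_pos h hs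
  -- The factor 2 absorbs the ceiling, and `exp (-log b) = 1 / b` the floor.
  have hlim : Tendsto (fun x : ℝ => 2 * Real.exp (-Real.log b) *
      Real.exp (-(-(ρ + Real.log b / s) * x))) atTop (𝓝 0) := by
    simpa using (Real.tendsto_exp_neg_atTop_nhds_zero.comp
      (tendsto_id.const_mul_atTop hneg)).const_mul (2 * Real.exp (-Real.log b))
  refine tendsto_of_tendsto_of_tendsto_of_le_of_le' tendsto_const_nhds hlim
    (Eventually.of_forall fun x => by positivity) ?_
  filter_upwards [eventually_ge_atTop 0] with x hx
  have h1 : (⌈Real.exp (ρ * x)⌉₊ : ℝ) ≤ 2 * Real.exp (ρ * x) := by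
    have h2 := (Nat.ceil_lt_add_one (Real.exp_pos (ρ * x)).le).le
    have h3 := Real.one_le_exp (mul_nonneg hρ hx)
    linarith
  have h4 : b ^ ⌊x / s⌋₊ ≤ Real.exp ((x / s - 1) * Real.log b) := by
    rw [← Real.rpow_natCast, Real.rpow_def_of_pos hb, Real.exp_le_exp, mul_comm]
    exact mul_le_mul_of_nonpos_right (Nat.sub_one_lt_floor _).le hlog.le
  calc _ ≤ 2 * Real.exp (ρ * x) * Real.exp ((x / s - 1) * Real.log b) := by gcongr
    _ = _ := by
      rw [mul_assoc, mul_assoc, ← Real.exp_add, ← Real.exp_add]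
      congr 2
      field_simp
      ring

lemma eventually_two_mul_exp_lt_one {a : ℝ} (ha : 0 < a) :
    ∀ᶠ ξ : ℝ in atTop, 2 * Real.exp (-(a * ξ ^ 2)) < 1 := by
  have h : Tendsto (fun ξ : ℝ => 2 * Real.exp (-(a * ξ ^ 2))) atTop (𝓝 0) := by
    simpa using (Real.tendsto_exp_neg_atTop_nhds_zero.comp
      ((tendsto_pow_atTop two_ne_zero).const_mul_atTop ha)).const_mul 2
  exact h.eventually_lt_const one_pos

theorem isAchievableByThreshold (hσ : 0 < σ) : IsAchievableByThreshold σ (1 / (2 * σ ^ 2)) := by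
  intro ε hε
  set C := 1 / (2 * σ ^ 2) with hC
  have hCpos : 0 < C := by positivity
  -- The target rate `ρ` is kept positive as well as above `C - ε`; then `η` is small enough that
  -- the false-alarm exponent still beats `ρ`.
  obtain ⟨ρ, hρ₁, hρC⟩ := exists_between (max_lt (sub_lt_self C hε) hCpos)
  obtain ⟨hρε, hρ⟩ := max_lt_iff.1 hρ₁
  obtain ⟨η, hη, hη1, hηρ⟩ : ∃ η : ℝ, 0 < η ∧ η < 1 ∧ ρ < (1 - η) ^ 3 * C := by
    have hcont : Tendsto (fun η : ℝ => (1 - η) ^ 3 * C) (𝓝[>] 0) (𝓝 ((1 - 0) ^ 3 * C)) :=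
      ((by fun_prop : Continuous fun η : ℝ => (1 - η) ^ 3 * C).tendsto 0).mono_left
        nhdsWithin_le_nhds
    have h1 := hcont.eventually_const_lt (u := ρ) (by simpa using hρC)
    obtain ⟨η, h2, h3⟩ := (h1.and (Ioo_mem_nhdsGT one_pos)).exists
    exact ⟨η, h3.1, h3.2, h2⟩
  -- The amplitude, and with it the threshold, is fixed before `E`. The three conditions make misses
  -- decay, false alarms decay, and false alarms decay faster than the number of messages grows.
  obtain ⟨ξ, hb₁, hb₂, hb₃, hξ⟩ := ((eventually_two_mul_exp_lt_one
    (a := η ^ 3 * C) (by positivity)).and <| (eventually_two_mul_exp_lt_one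
    (a := (1 - η) ^ 3 * C) (hρ.trans hηρ)).and <| (eventually_two_mul_exp_lt_one
    (a := (1 - η) ^ 3 * C - ρ) (sub_pos.2 hηρ)).and (eventually_gt_atTop 0)).exists
  have hξ2 : 0 < ξ ^ 2 := by positivity
  have hL (E : ℝ≥0) : (⌊(E : ℝ) / ξ ^ 2⌋₊ : ℝ) * ξ ^ 2 ≤ E := by
    rw [← le_div_iff₀ hξ2]
    exact Nat.floor_le (by positivity)
  have hM (E : ℝ≥0) : 0 < ⌈Real.exp (ρ * E)⌉₊ := Nat.ceil_pos.2 (Real.exp_pos _)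
  have hcoe : Tendsto (fun E : ℝ≥0 => (E : ℝ)) atTop atTop := NNReal.tendsto_coe_atTop.2 tendsto_id
  refine ⟨(1 - η) * ξ, fun E => pulsePositionCode ξ ((1 - η) * ξ) (1 - η) _ _ (hM E) (hL E),
    fun E => rfl, ?_, ?_⟩
  · filter_upwards [eventually_gt_atTop 0] with E hE
    refine hρε.trans_le ?_
    change ρ ≤ Real.log (⌈Real.exp (ρ * E)⌉₊ : ℝ) / E
    rw [le_div_iff₀ (NNReal.coe_pos.2 hE), Real.le_log_iff_exp_le (Nat.cast_pos.2 (hM E))]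
    exact Nat.le_ceil _
  · have hlog : ρ * ξ ^ 2 + Real.log (2 * Real.exp (-((1 - η) ^ 3 * C * ξ ^ 2))) < 0 := by
      have h := Real.log_neg (by positivity) hb₃
      rw [Real.log_mul two_ne_zero (Real.exp_pos _).ne', Real.log_exp] at h ⊢
      linarith
    have hlim₁ : Tendsto (fun E : ℝ≥0 =>
        (2 * Real.exp (-(η ^ 3 * C * ξ ^ 2))) ^ ⌊(E : ℝ) / ξ ^ 2⌋₊) atTop (𝓝 0) :=
      (tendsto_pow_atTop_nhds_zero_of_lt_one (by positivity) hb₁).comp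
        (tendsto_nat_floor_atTop.comp (hcoe.atTop_div_const hξ2))
    have hlim₂ := (tendsto_ceil_exp_mul_pow_floor hρ.le hξ2 (by positivity) hb₂ hlog).comp hcoe
    refine squeeze_zero (fun E => ?_) (fun E => ?_) (by simpa using hlim₁.add hlim₂)
    · exact div_nonneg (Finset.sum_nonneg fun _ _ => measureReal_nonneg) (Nat.cast_nonneg _)
    · refine (pulsePositionCode_errorProb_le hξ.le hη.le hη1.le (hM E) (hL E)).trans_eq ?_
      have hrw (a : ℝ) : a ^ 3 * ξ ^ 2 / (2 * σ ^ 2) = a ^ 3 * C * ξ ^ 2 := by rw [hC]; ring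
      simp only [hrw]

/-! ### Comparison of the three notions of achievability -/

lemma IsAchievableByThreshold.isAchievable {R : ℝ} (h : IsAchievableByThreshold σ R) :
    IsAchievable σ R := fun ε hε =>
  let ⟨_, code, _, hrate, herr⟩ := h ε hε
  ⟨code, hrate, herr⟩

lemma measurable_quantize {D : Set ℝ} (hD : MeasurableSet D) : Measurable (quantize D) :=
  Measurable.ite hD measurable_const measurable_const

instance : MeasurableSingletonClass ℤˣ where
  measurableSet_singleton u := ⟨{(u : ℤ)}, measurableSet_singleton _, by ext v; simp [Units.ext_iff]⟩

/-- A decoder for the unquantized channel can quantize the outputs itself. -/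
noncomputable def QuantizedCode.toUnquantizedCode {E : ℝ≥0} (c : QuantizedCode E) : UnquantizedCode E where
  toEncoder := c.toEncoder
  decoder y := c.decoder fun k => quantize c.region (y k)
  measurable_decoder := (measurable_of_countable c.decoder).comp <| measurable_pi_lambda _ fun k =>
    (measurable_quantize c.measurableSet_region).comp (measurable_pi_apply k)

lemma IsAchievable.isAchievableUnquantized {R : ℝ} (h : IsAchievable σ R) :
    IsAchievableUnquantized σ R := fun ε hε =>
  let ⟨code, hrate, herr⟩ := h ε hε
  ⟨fun E => (code E).toUnquantizedCode, hrate, herr⟩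

end OneBit

theorem theorem1 (σ : ℝ) (hσ : 0 < σ) :
    OneBit.capacityPerUnitEnergy σ = ((1 / (2 * σ ^ 2) : ℝ) : EReal) ∧
    OneBit.capacityPerUnitEnergyUnquantized σ = ((1 / (2 * σ ^ 2) : ℝ) : EReal) ∧
    OneBit.IsAchievableByThreshold σ (1 / (2 * σ ^ 2)) := by
  have hthr := OneBit.isAchievableByThreshold hσ
  refine ⟨le_antisymm ?_ ?_, le_antisymm ?_ ?_, hthr⟩
  · exact iSup₂_le fun R hR => EReal.coe_le_coe (hR.isAchievableUnquantized.le hσ)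
  · exact le_iSup₂ (f := fun (R : ℝ) (_ : R ∈ {R : ℝ | OneBit.IsAchievable σ R}) => (R : EReal))
      _ hthr.isAchievable
  · exact iSup₂_le fun R hR => EReal.coe_le_coe (hR.le hσ)
  · exact le_iSup₂
      (f := fun (R : ℝ) (_ : R ∈ {R : ℝ | OneBit.IsAchievableUnquantized σ R}) => (R : EReal))
      _ hthr.isAchievable.isAchievableUnquantized
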